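/- **Lemma 2.1.** Let $n\ge 0$ be an integer, let $S^n$ be the unit sphere centered at the origin of $\mathbb{R}^{n+1}$ with its surface area measure, and for $P\in S^n$ let $P_\perp=\{Q\in S^n : \langle P,Q\rangle=0\}$ be the equator associated with $P$. Let $I\subseteq\mathbb{R}$ be an interval of any kind (bounded or unbounded, with or without its endpoints) and let $\gamma\colon I\to S^n$ be a rectifiable curve, i.e. $\gamma$ is continuous and its length $$|\gamma|=\sup_{t_0\le t_1\le\dots\le t_k,\ t_i\in I}\ \sum_{i=1}^{k}\|\gamma(t_i)-\gamma(t_{i-1})\|$$ is finite. Let the multiplicity of $Q\in S^n$ be $m_\gamma(Q)=\#\{t\in I : Q\in\gamma(t)_\perp\}\in\{0,1,2,\dots,\infty\}$, and let $|\gamma_\perp|$ be the area swept out by the equators of $\gamma$, counted with multiplicity, i.e. the integral of $m_\gamma$ with respect to surface area over $\bigcup_{t\in I}\gamma(t)_\perp$. Then $m_\gamma$ is Borel measurable and $$\frac{|\gamma_\perp|}{\operatorname{area}(S^n)}=\frac{|\gamma|}{\pi}.$$ -/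

import Mathlib

open MeasureTheory
open scoped ENNReal

noncomputable section

namespace EquatorCrofton

/-- The unit sphere `S^n`, centred at the origin of the Euclidean space `ℝ^(n+1)`. -/
abbrev UnitSphere (n : ℕ) : Type :=
  Metric.sphere (0 : EuclideanSpace ℝ (Fin (n + 1))) 1

/-- The (`n`-dimensional) surface area measure on `S^n`: a Borel set `A` has area
`(n + 1) * vol {r • Q | 0 < r < 1, Q ∈ A}`. -/
def surfaceArea (n : ℕ) : Measure (UnitSphere n) :=
  (volume : Measure (EuclideanSpace ℝ (Fin (n + 1)))).toSphere

/-- The equator associated with `P ∈ S^n`: the points of `S^n` perpendicular to `P`. -/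
def equator {n : ℕ} (P : UnitSphere n) : Set (UnitSphere n) :=
  {Q | inner ℝ (P : EuclideanSpace ℝ (Fin (n + 1))) (Q : EuclideanSpace ℝ (Fin (n + 1))) = 0}

/-- The equators of a curve with parameter interval `I`: the family of all `equator P`, where `P`
runs over the points of the curve. -/
def equatorsOfCurve {n : ℕ} (γ : ℝ → UnitSphere n) (I : Set ℝ) : Set (Set (UnitSphere n)) :=
  {C | ∃ P ∈ γ '' I, C = equator P}

/-- The multiplicity of `Q`: the number (possibly `∞`) of parameters `t ∈ I` such that `Q` lies on
the equator of `γ t`. -/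
def multiplicity {n : ℕ} (γ : ℝ → UnitSphere n) (I : Set ℝ) (Q : UnitSphere n) : ℝ≥0∞ :=
  ({t ∈ I | Q ∈ equator (γ t)}.encard : ℝ≥0∞)

/-- The area swept out by the equators of a curve, counting multiplicity: the integral of the
multiplicity over the union of the equators of the curve. -/
def sweptArea {n : ℕ} (γ : ℝ → UnitSphere n) (I : Set ℝ) : ℝ≥0∞ :=
  ∫⁻ Q in ⋃₀ equatorsOfCurve γ I, multiplicity γ I Q ∂(surfaceArea n)

/-- The length of a curve with parameter interval `I`: the supremum of the lengths
`∑ ‖γ (t (i + 1)) - γ (t i)‖` of the inscribed polygons in `ℝ^(n+1)`, with `t i ∈ I` monotone. -/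
def curveLength {n : ℕ} (γ : ℝ → UnitSphere n) (I : Set ℝ) : ℝ≥0∞ :=
  eVariationOn (fun t => (γ t : EuclideanSpace ℝ (Fin (n + 1)))) I

/-- A rectifiable curve: `I` is an interval of any kind (bounded or not; open, closed or half-open),
`γ` is continuous on `I`, and the length is finite. Values of `γ` outside `I` play no role. -/
structure IsRectifiableCurve {n : ℕ} (γ : ℝ → UnitSphere n) (I : Set ℝ) : Prop where
  ordConnected : I.OrdConnected
  continuousOn : ContinuousOn γ I
  length_ne_top : curveLength γ I ≠ ∞

end EquatorCrofton

end

/-!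
The formula is a Crofton formula, and `multiplicity γ I Q` is the Banach indicatrix of the function
`t ↦ ⟪γ t, Q⟫` at the value `0`. Write `T` for the area of the sphere and `L` for the length.

*Lunes.* The points `Q` for which `⟪P, Q⟫` and `⟪P', Q⟫` have strictly opposite signs form a double
lune, of area `T * angle P P' / π` (`volume_lune`, `surfaceArea_lune`). On a fixed great circle the
area depends on the angle only, by reflection invariance, and is additive in it; a nonnegative
additive function is linear (`eq_mul_of_additive_nonneg`). The angle is at least the chord, and
agrees with it to third order.

*Lower bound.* For an inscribed polygon, every side whose lune contains `Q` carries a parameter of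
its own with `⟪γ t, Q⟫ = 0`, by the intermediate value theorem. So the integral of the multiplicity
is at least the sum of the areas of the lunes, hence at least `T / π` times the length of the
polygon (`le_lintegral_multiplicity`).

*Upper bound.* For an interval `J` let `hitSet γ J` be the union of the equators of `γ t`, `t ∈ J`.
If `Q` lies in it, then off a null set `⟪γ t, Q⟫` takes both signs on `J`
(`ae_exists_inner_pos_and_neg`): the points `Q` at which the maximum of `⟪γ t, Q⟫` is attained and
equals `0` lie on the frontier of the convex cone `{x | ∀ t ∈ J, ⟪γ t, x⟫ ≤ 0}`, which is null. No
differentiability of the curve is needed. Again off a null set, a point at which both signs occur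
lies in the lune of some pair of neighbours of each sufficiently fine uniform partition, whence
`area (hitSet γ J) ≤ T * length (J) / π` (`surfaceArea_hitSet_Icc_le`, `surfaceArea_hitSet_le`).

*From hit sets to the multiplicity.* The number of cells of a grid of mesh `1 / k` whose hit set
contains `Q` is at most the multiplicity of `Q` and converges to it as `k → ∞`
(`multiplicity_eq_liminf`). Hit sets of intervals are countable unions of closed sets, so that the
multiplicity is Borel measurable; and since length is superadditive over the cells, Fatou's lemma
yields `∫ multiplicity ≤ T * L / π` (`lintegral_multiplicity_le`).
-/

namespace EquatorCrofton

open InnerProductGeometry Set Metric Filter Topology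
open scoped RealInnerProductSpace Pointwise

/-! ### Additive functions on an interval -/

/-- A nonnegative function which is additive on `[0, M]` is linear there. -/
theorem eq_mul_of_additive_nonneg {g : ℝ → ℝ} {M : ℝ} (hM : 0 < M)
    (hadd : ∀ a b, 0 ≤ a → 0 ≤ b → a + b ≤ M → g (a + b) = g a + g b)
    (hnn : ∀ a, 0 ≤ g a) {x : ℝ} (hx0 : 0 ≤ x) (hxM : x ≤ M) : g x = x / M * g M := by
  have hmono : ∀ a b, 0 ≤ a → a ≤ b → b ≤ M → g a ≤ g b := fun a b ha hab hb ↦ by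
    have := hadd a (b - a) ha (by linarith) (by linarith)
    rw [add_sub_cancel] at this
    linarith [hnn (b - a)]
  have hmul : ∀ (k : ℕ) (y : ℝ), 0 ≤ y → k * y ≤ M → g (k * y) = k * g y := by
    intro k y hy
    induction k with
    | zero =>
      intro _
      have := hadd 0 0 le_rfl le_rfl (by simpa using hM.le)
      simp only [add_zero] at this
      simp only [Nat.cast_zero, zero_mul]
      linarith
    | succ k ih =>
      intro h
      push_cast at h ⊢
      have hk : 0 ≤ (k : ℝ) * y := by positivity
      rw [add_mul, one_mul, hadd _ _ hk hy (by linarith), ih (by linarith)]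
      ring
  rcases hxM.eq_or_lt with rfl | hlt
  · field_simp
  -- compare `x` with the neighbouring multiples of `M / N`
  have key : ∀ N : ℕ, 0 < N → |g x - x / M * g M| ≤ g M / N := by
    intro N hN
    have hN' : (0 : ℝ) < N := by exact_mod_cast hN
    have hy : 0 ≤ M / N := by positivity
    have hgN : g (M / N) = g M / N := by
      have := hmul N (M / N) hy (by field_simp; exact le_rfl)
      rw [mul_div_cancel₀ _ hN'.ne'] at this
      field_simp
      linarith
    set k := ⌊x * N / M⌋₊
    have hk1 : (k : ℝ) ≤ x * N / M := Nat.floor_le (by positivity)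
    have hk2 : x * N / M < k + 1 := Nat.lt_floor_add_one _
    have hkN : k + 1 ≤ N := by
      have : (k : ℝ) < N := hk1.trans_lt (by rw [div_lt_iff₀ hM]; nlinarith)
      exact_mod_cast this
    have hkN' : ((k + 1 : ℕ) : ℝ) ≤ N := by exact_mod_cast hkN
    have e1 : (k : ℝ) * (M / N) ≤ x := by
      rw [le_div_iff₀ hM] at hk1; rw [← mul_div_assoc, div_le_iff₀ hN']; exact hk1
    have e2 : x ≤ ((k + 1 : ℕ) : ℝ) * (M / N) := by
      rw [div_lt_iff₀ hM] at hk2; rw [← mul_div_assoc, le_div_iff₀ hN']; push_cast; exact hk2.le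
    have e3 : ((k + 1 : ℕ) : ℝ) * (M / N) ≤ M := by
      rw [← mul_div_assoc, div_le_iff₀ hN']; nlinarith
    have l1 := hmono _ _ (by positivity) e1 hxM
    have l2 := hmono _ _ hx0 e2 e3
    rw [hmul k _ hy (by linarith), hgN] at l1
    rw [hmul (k + 1) _ hy e3, hgN] at l2
    push_cast at l2
    have hc : x / M * g M = x * N / M * (g M / N) := by field_simp
    have hG : 0 ≤ g M / N := div_nonneg (hnn M) hN'.le
    rw [hc, abs_le]
    constructor <;> nlinarith
  have hlim : Tendsto (fun N : ℕ ↦ g M / N) atTop (𝓝 0) :=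
    tendsto_const_div_atTop_nhds_zero_nat _
  have h0 : |g x - x / M * g M| ≤ 0 := by
    refine ge_of_tendsto hlim ?_
    filter_upwards [eventually_gt_atTop 0] with N hN using key N hN
  linarith [abs_nonpos_iff.1 h0]

/-! ### Lunes and great circles -/

section

variable {E : Type*} [NormedAddCommGroup E] [InnerProductSpace ℝ E]

/-- The open double lune spanned by `P` and `P'`, as a cone in the ambient space: the points
at which the linear forms `⟪P, ·⟫` and `⟪P', ·⟫` have strictly opposite signs. -/
def lune (P P' : E) : Set E := {x | ⟪P, x⟫ * ⟪P', x⟫ < 0}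

theorem isOpen_lune (P P' : E) : IsOpen (lune P P') :=
  isOpen_lt (by fun_prop) continuous_const

theorem lune_comm (P P' : E) : lune P P' = lune P' P := by
  simp only [lune, mul_comm]

theorem lune_self (P : E) : lune P P = ∅ := by
  ext x; simp [lune, mul_self_nonneg]

theorem smul_mem_lune {P P' x : E} (hx : x ∈ lune P P') {r : ℝ} (hr : 0 < r) :
    r • x ∈ lune P P' := by
  simp only [lune, mem_ofPred_eq, inner_smul_right] at hx ⊢
  nlinarith [mul_pos hr hr]

/-- The point at angle `s` on the great circle through the orthonormal pair `e₀`, `e₁`. -/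
noncomputable def circlePoint (e₀ e₁ : E) (s : ℝ) : E := Real.cos s • e₀ + Real.sin s • e₁

theorem circlePoint_zero (e₀ e₁ : E) : circlePoint e₀ e₁ 0 = e₀ := by simp [circlePoint]

theorem circlePoint_pi (e₀ e₁ : E) : circlePoint e₀ e₁ Real.pi = -e₀ := by simp [circlePoint]

theorem inner_circlePoint {e₀ e₁ : E} (h₀ : ‖e₀‖ = 1) (h₁ : ‖e₁‖ = 1) (h : ⟪e₀, e₁⟫ = 0)
    (s t : ℝ) : ⟪circlePoint e₀ e₁ s, circlePoint e₀ e₁ t⟫ = Real.cos (s - t) := by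
  have h' : ⟪e₁, e₀⟫ = 0 := by rw [real_inner_comm]; exact h
  simp only [circlePoint, inner_add_left, inner_add_right, real_inner_smul_left,
    real_inner_smul_right, real_inner_self_eq_norm_sq, h₀, h₁, h, h', Real.cos_sub]
  ring

theorem norm_circlePoint {e₀ e₁ : E} (h₀ : ‖e₀‖ = 1) (h₁ : ‖e₁‖ = 1) (h : ⟪e₀, e₁⟫ = 0)
    (s : ℝ) : ‖circlePoint e₀ e₁ s‖ = 1 := by
  rw [← sq_eq_sq₀ (norm_nonneg _) zero_le_one, ← real_inner_self_eq_norm_sq,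
    inner_circlePoint h₀ h₁ h]
  simp

/-- The reflection in the line through the point at angle `φ` reverses the great circle. -/
theorem reflection_circlePoint {e₀ e₁ : E} (h₀ : ‖e₀‖ = 1) (h₁ : ‖e₁‖ = 1) (h : ⟪e₀, e₁⟫ = 0)
    (φ s : ℝ) : (ℝ ∙ circlePoint e₀ e₁ φ).reflection (circlePoint e₀ e₁ s) =
      circlePoint e₀ e₁ (2 * φ - s) := by
  have hc : Real.cos (2 * φ - s) = 2 * Real.cos (φ - s) * Real.cos φ - Real.cos s := by
    have e1 := Real.cos_add φ (φ - s)
    have e2 := Real.cos_sub φ (φ - s)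
    rw [show φ + (φ - s) = 2 * φ - s by ring] at e1
    rw [show φ - (φ - s) = s by ring] at e2
    linarith
  have hs : Real.sin (2 * φ - s) = 2 * Real.cos (φ - s) * Real.sin φ - Real.sin s := by
    have e1 := Real.sin_add φ (φ - s)
    have e2 := Real.sin_sub φ (φ - s)
    rw [show φ + (φ - s) = 2 * φ - s by ring] at e1
    rw [show φ - (φ - s) = s by ring] at e2
    linarith
  rw [Submodule.reflection_singleton_apply, inner_circlePoint h₀ h₁ h, norm_circlePoint h₀ h₁ h]
  simp only [circlePoint, hc, hs]
  simp
  module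

/-- The point at angle `a` is a nonnegative combination of the points at angles `0` and `a + b`. -/
theorem sin_smul_circlePoint (e₀ e₁ : E) (a b : ℝ) :
    Real.sin (a + b) • circlePoint e₀ e₁ a =
      Real.sin b • e₀ + Real.sin a • circlePoint e₀ e₁ (a + b) := by
  have : Real.sin (a + b) * Real.cos a = Real.sin b + Real.sin a * Real.cos (a + b) := by
    rw [Real.sin_add, Real.cos_add]
    linear_combination Real.sin b * Real.sin_sq_add_cos_sq a
  simp only [circlePoint, smul_add, smul_smul, this]
  module

/-- Two unit vectors which are neither equal nor opposite span a great circle. -/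
theorem exists_eq_circlePoint {P P' : E} (hP : ‖P‖ = 1) (hP' : ‖P'‖ = 1)
    (hs : Real.sin (angle P P') ≠ 0) :
    ∃ e : E, ‖e‖ = 1 ∧ ⟪P, e⟫ = 0 ∧ P' = circlePoint P e (angle P P') := by
  have hc : ⟪P, P'⟫ = Real.cos (angle P P') := by
    rw [cos_angle, hP, hP']; simp
  set θ := angle P P'
  have hpos : 0 < Real.sin θ := lt_of_le_of_ne (sin_angle_nonneg P P') hs.symm
  have h0 : ⟪P, P' - Real.cos θ • P⟫ = 0 := by
    rw [inner_sub_right, real_inner_smul_right, real_inner_self_eq_norm_sq, hP, hc]; ring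
  refine ⟨(Real.sin θ)⁻¹ • (P' - Real.cos θ • P), ?_, ?_, ?_⟩
  · have hn : ‖P' - Real.cos θ • P‖ = Real.sin θ := by
      rw [← sq_eq_sq₀ (norm_nonneg _) hpos.le, norm_sub_sq_real, norm_smul, hP, hP',
        real_inner_smul_right, real_inner_comm, hc, Real.sin_sq]
      simp
      ring
    rw [norm_smul, hn, norm_inv, Real.norm_of_nonneg hpos.le, inv_mul_cancel₀ hs]
  · rw [real_inner_smul_right, h0, mul_zero]
  · simp [circlePoint, smul_smul, hs]

theorem norm_sub_eq_two_mul_sin {P P' : E} (hP : ‖P‖ = 1) (hP' : ‖P'‖ = 1) :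
    ‖P - P'‖ = 2 * Real.sin (angle P P' / 2) := by
  have h2 : 0 ≤ Real.sin (angle P P' / 2) := Real.sin_nonneg_of_nonneg_of_le_pi
    (by linarith [angle_nonneg P P']) (by linarith [angle_le_pi P P', Real.pi_pos])
  have hc : ⟪P, P'⟫ = Real.cos (angle P P') := by rw [cos_angle, hP, hP']; simp
  rw [← sq_eq_sq₀ (norm_nonneg _) (by positivity), norm_sub_sq_real, hP, hP', hc, mul_pow,
    Real.sin_sq_eq_half_sub]
  rw [show 2 * (angle P P' / 2) = angle P P' by ring]
  ring

theorem norm_sub_le_angle {P P' : E} (hP : ‖P‖ = 1) (hP' : ‖P'‖ = 1) :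
    ‖P - P'‖ ≤ angle P P' := by
  rw [norm_sub_eq_two_mul_sin hP hP']
  linarith [Real.sin_le (show 0 ≤ angle P P' / 2 by linarith [angle_nonneg P P'])]

/-- The angle between two unit vectors agrees with their distance up to third order. -/
theorem angle_mul_le_norm_sub {P P' : E} (hP : ‖P‖ = 1) (hP' : ‖P'‖ = 1) :
    angle P P' * (1 - ‖P - P'‖ ^ 2) ≤ ‖P - P'‖ := by
  have h := norm_sub_eq_two_mul_sin hP hP'
  set x := angle P P' / 2 with hx
  set d := ‖P - P'‖
  have hθ : angle P P' = 2 * x := by rw [hx]; ring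
  have hx0 : 0 ≤ x := by linarith [angle_nonneg P P']
  -- Jordan's inequality bounds the angle by a multiple of the chord
  have hj : 2 / Real.pi * x ≤ Real.sin x :=
    Real.mul_le_sin hx0 (by linarith [angle_le_pi P P'])
  have hxd : x ≤ d := by
    rw [div_mul_eq_mul_div, div_le_iff₀ Real.pi_pos] at hj
    nlinarith [Real.pi_le_four, Real.pi_pos, norm_nonneg (P - P')]
  have hcube : x - x ^ 3 / 6 ≤ Real.sin x := by
    rcases hx0.eq_or_lt with h0 | h0
    · simp [← h0]
    · exact (Real.sin_gt_sub_cube h0).le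
  have h3 : x * x ^ 2 ≤ x * d ^ 2 := by gcongr
  have h4 : 0 ≤ x * x ^ 2 := by positivity
  rw [hθ]
  nlinarith

end

/-! ### The content of a lune -/

section

variable {E : Type*} [NormedAddCommGroup E] [InnerProductSpace ℝ E]
variable [FiniteDimensional ℝ E] [MeasurableSpace E] [BorelSpace E]

theorem volume_perp_eq_zero {P : E} (hP : P ≠ 0) : volume {x : E | ⟪P, x⟫ = 0} = 0 := by
  have : {x : E | ⟪P, x⟫ = 0} = ((ℝ ∙ P)ᗮ : Submodule ℝ E) := by
    ext x; simp [Submodule.mem_orthogonal_singleton_iff_inner_right]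
  rw [this]
  refine Measure.addHaar_submodule _ _ fun h ↦ hP ?_
  have h1 : P ∈ (ℝ ∙ P)ᗮ := h ▸ Submodule.mem_top
  simpa [Submodule.mem_orthogonal_singleton_iff_inner_right] using h1

theorem ae_inner_ne_zero {P : E} (hP : P ≠ 0) : ∀ᵐ x : E, ⟪P, x⟫ ≠ 0 := by
  rw [ae_iff]
  simpa using volume_perp_eq_zero hP

theorem volume_lune_map (R : E ≃ₗᵢ[ℝ] E) (P P' : E) :
    volume (lune (R P) (R P') ∩ ball 0 1) = volume (lune P P' ∩ ball 0 1) := by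
  rw [← R.measurePreserving.measure_preimage
    ((isOpen_lune _ _).inter isOpen_ball).measurableSet.nullMeasurableSet]
  congr 1
  ext x
  simp [lune]


variable {e₀ e₁ : E}

/-- By reflection in the bisecting line, the content of a lune on a fixed great circle depends only
on its angle. -/
theorem volume_lune_circlePoint (h₀ : ‖e₀‖ = 1) (h₁ : ‖e₁‖ = 1) (h : ⟪e₀, e₁⟫ = 0) (a b : ℝ) :
    volume (lune (circlePoint e₀ e₁ a) (circlePoint e₀ e₁ (a + b)) ∩ ball 0 1) =
      volume (lune e₀ (circlePoint e₀ e₁ b) ∩ ball 0 1) := by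
  rw [← volume_lune_map (ℝ ∙ circlePoint e₀ e₁ ((a + b) / 2)).reflection,
    reflection_circlePoint h₀ h₁ h, reflection_circlePoint h₀ h₁ h, lune_comm]
  rw [show 2 * ((a + b) / 2) - a = b by ring, show 2 * ((a + b) / 2) - (a + b) = 0 by ring,
    circlePoint_zero]

/-- The content of a lune on a fixed great circle is additive in the angle: off the hyperplane
perpendicular to the intermediate point, a sign change over the sum of two arcs is a sign change
over exactly one of the arcs. -/
theorem volume_lune_add (h₀ : ‖e₀‖ = 1) (h₁ : ‖e₁‖ = 1) (h : ⟪e₀, e₁⟫ = 0) {a b : ℝ}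
    (ha : 0 ≤ a) (hb : 0 ≤ b) (hab : a + b ≤ Real.pi) :
    volume (lune e₀ (circlePoint e₀ e₁ (a + b)) ∩ ball 0 1) =
      volume (lune e₀ (circlePoint e₀ e₁ a) ∩ ball 0 1) +
        volume (lune e₀ (circlePoint e₀ e₁ b) ∩ ball 0 1) := by
  rcases ha.eq_or_lt with rfl | ha
  · simp [circlePoint_zero, lune_self]
  rcases hb.eq_or_lt with rfl | hb
  · simp [circlePoint_zero, lune_self]
  have hsa : 0 < Real.sin a := Real.sin_pos_of_pos_of_lt_pi ha (by linarith)
  have hsb : 0 < Real.sin b := Real.sin_pos_of_pos_of_lt_pi hb (by linarith)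
  have hsab : 0 ≤ Real.sin (a + b) := Real.sin_nonneg_of_nonneg_of_le_pi (by linarith) hab
  have hlin : ∀ x, Real.sin (a + b) * ⟪circlePoint e₀ e₁ a, x⟫ =
      Real.sin b * ⟪e₀, x⟫ + Real.sin a * ⟪circlePoint e₀ e₁ (a + b), x⟫ := fun x ↦ by
    have := congrArg (fun y ↦ ⟪y, x⟫) (sin_smul_circlePoint e₀ e₁ a b)
    simpa only [inner_add_left, real_inner_smul_left] using this
  rw [← volume_lune_circlePoint h₀ h₁ h a b]
  set A := circlePoint e₀ e₁ a with hA
  set B := circlePoint e₀ e₁ (a + b)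
  have hA0 : A ≠ 0 := by
    intro h'
    have := norm_circlePoint h₀ h₁ h a
    rw [← hA, h'] at this
    simp at this
  rw [← measure_union _ ((isOpen_lune _ _).inter isOpen_ball).measurableSet]
  · refine measure_congr (eventuallyEq_set.2 ?_)
    filter_upwards [ae_inner_ne_zero hA0] with x hx
    have hl := hlin x
    rw [← union_inter_distrib_right]
    refine and_congr_left fun _ ↦ ?_
    simp only [lune, mem_union, mem_ofPred_eq, mul_neg_iff]
    set p := ⟪e₀, x⟫
    set q := ⟪A, x⟫
    set r := ⟪B, x⟫
    constructor
    · rintro (⟨hp, hr⟩ | ⟨hp, hr⟩) <;> rcases lt_or_gt_of_ne hx with hq | hq <;> simp [hp, hr, hq]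
    · rintro ((⟨hp, hq⟩ | ⟨hp, hq⟩) | (⟨hp, hq⟩ | ⟨hp, hq⟩))
      · refine Or.inl ⟨hp, ?_⟩; by_contra! hc; nlinarith [mul_pos hsb hp]
      · refine Or.inr ⟨hp, ?_⟩; by_contra! hc; nlinarith [mul_pos hsb (neg_pos.2 hp)]
      · refine Or.inl ⟨?_, hq⟩; by_contra! hc; nlinarith [mul_pos hsa (neg_pos.2 hq)]
      · refine Or.inr ⟨?_, hq⟩; by_contra! hc; nlinarith [mul_pos hsa hq]
  · refine disjoint_left.2 fun x hx hx' ↦ ?_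
    have hl := hlin x
    have h1 := hx.1
    have h2 := hx'.1
    simp only [lune, mem_ofPred_eq, mul_neg_iff] at h1 h2
    set p := ⟪e₀, x⟫
    set q := ⟪A, x⟫
    set r := ⟪B, x⟫
    rcases h1 with ⟨hp, hq⟩ | ⟨hp, hq⟩ <;> rcases h2 with ⟨hq', hr⟩ | ⟨hq', hr⟩
    · linarith
    · nlinarith [mul_pos hsb hp, mul_pos hsa hr]
    · nlinarith [mul_pos hsb (neg_pos.2 hp), mul_pos hsa (neg_pos.2 hr)]
    · linarith

theorem volume_lune_neg {P : E} (hP : P ≠ 0) :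
    volume (lune P (-P) ∩ ball 0 1) = volume (ball (0 : E) 1) := by
  refine measure_congr (eventuallyEq_set.2 ?_)
  filter_upwards [ae_inner_ne_zero hP] with x hx
  simp only [mem_inter_iff, and_iff_right_iff_imp, lune, mem_ofPred_eq, inner_neg_left]
  intro _
  nlinarith [mul_self_pos.2 hx]

/-- The content of a double lune is proportional to its angle. -/
theorem volume_lune {P P' : E} (hP : ‖P‖ = 1) (hP' : ‖P'‖ = 1) :
    volume (lune P P' ∩ ball 0 1) =
      ENNReal.ofReal (angle P P' / Real.pi) * volume (ball (0 : E) 1) := by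
  have hP0 : P ≠ 0 := by rintro rfl; simp at hP
  by_cases hs : Real.sin (angle P P') = 0
  · rcases sin_eq_zero_iff_angle_eq_zero_or_angle_eq_pi.1 hs with h | h
    · have hPP : P = P' := by
        have := norm_sub_le_angle hP hP'
        rw [h] at this
        exact sub_eq_zero.1 (norm_le_zero_iff.1 this)
      rw [h, hPP, lune_self]; simp
    · have hPP : P' = -P := by
        have := norm_sub_le_angle hP (P' := -P') (by simpa using hP')
        rw [angle_neg_right, h, sub_self, sub_neg_eq_add] at this
        exact (neg_eq_of_add_eq_zero_right (norm_le_zero_iff.1 this)).symm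
      rw [h, hPP, div_self Real.pi_ne_zero, volume_lune_neg hP0]; simp
  · obtain ⟨e, he, hPe, hPP⟩ := exists_eq_circlePoint hP hP' hs
    set θ := angle P P'
    have hfin : ∀ s : Set E, volume (s ∩ ball 0 1) ≠ ∞ := fun s ↦
      measure_ne_top_of_subset inter_subset_right measure_ball_lt_top.ne
    have key := eq_mul_of_additive_nonneg
      (g := fun s ↦ (volume (lune P (circlePoint P e s) ∩ ball 0 1)).toReal) Real.pi_pos
      (fun a b ha hb hab ↦ by
        rw [volume_lune_add hP he hPe ha hb hab, ENNReal.toReal_add (hfin _) (hfin _)])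
      (fun _ ↦ ENNReal.toReal_nonneg) (angle_nonneg P P') (angle_le_pi P P')
    simp only [circlePoint_pi, volume_lune_neg hP0] at key
    rw [← ENNReal.ofReal_toReal (hfin (lune P P')), hPP, key, ENNReal.ofReal_mul
      (div_nonneg (angle_nonneg _ _) Real.pi_pos.le), ENNReal.ofReal_toReal measure_ball_lt_top.ne]

end

/-! ### Surface area -/

section

variable {n : ℕ}

local notation "𝔼" n => EuclideanSpace ℝ (Fin (n + 1))

/-- The area of the trace of a cone on the sphere, in terms of the part of the cone in the unit
ball. -/
theorem surfaceArea_preimage_cone {A : Set (𝔼 n)} (hA : MeasurableSet A)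
    (hcone : ∀ x ∈ A, ∀ r : ℝ, 0 < r → r • x ∈ A) :
    surfaceArea n (Subtype.val ⁻¹' A) = (n + 1 : ℕ) * volume (A ∩ ball 0 1) := by
  have hset : Ioo (0 : ℝ) 1 • (Subtype.val '' (Subtype.val ⁻¹' A : Set (UnitSphere n))) =
      (A ∩ ball 0 1) \ {0} := by
    ext x
    simp only [Set.mem_smul, mem_image, mem_preimage, Set.mem_sdiff, mem_inter_iff,
      mem_singleton_iff, mem_ball_zero_iff]
    constructor
    · rintro ⟨r, hr, _, ⟨Q, hQ, rfl⟩, rfl⟩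
      have hQ1 : ‖(Q : 𝔼 n)‖ = 1 := norm_eq_of_mem_sphere Q
      refine ⟨⟨hcone _ hQ r hr.1, ?_⟩, smul_ne_zero hr.1.ne' (ne_zero_of_mem_unit_sphere Q)⟩
      rw [norm_smul, hQ1, mul_one, Real.norm_of_nonneg hr.1.le]
      exact hr.2
    · rintro ⟨⟨hxA, hx1⟩, hx0⟩
      have hpos : 0 < ‖x‖ := norm_pos_iff.2 hx0
      refine ⟨‖x‖, ⟨hpos, hx1⟩, ‖x‖⁻¹ • x, ⟨⟨‖x‖⁻¹ • x, ?_⟩, ?_, rfl⟩, ?_⟩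
      · simp [norm_smul, hpos.ne']
      · exact hcone x hxA _ (inv_pos.2 hpos)
      · rw [smul_smul, mul_inv_cancel₀ hpos.ne', one_smul]
  rw [surfaceArea, Measure.toSphere_apply' _ (measurable_subtype_coe hA), hset,
    measure_sdiff_null (measure_singleton _)]
  simp

theorem surfaceArea_preimage_cone_eq_zero {A : Set (𝔼 n)} (hA : MeasurableSet A)
    (hcone : ∀ x ∈ A, ∀ r : ℝ, 0 < r → r • x ∈ A) (h0 : volume A = 0) :
    surfaceArea n (Subtype.val ⁻¹' A) = 0 := by
  rw [surfaceArea_preimage_cone hA hcone, measure_inter_null_of_null_left _ h0, mul_zero]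

instance instIsFiniteMeasureSurfaceArea : IsFiniteMeasure (surfaceArea n) := by
  unfold surfaceArea; infer_instance

theorem surfaceArea_univ :
    surfaceArea n univ = (n + 1 : ℕ) * volume (ball (0 : 𝔼 n) 1) := by
  simp [surfaceArea]

theorem surfaceArea_univ_ne_zero : surfaceArea n univ ≠ 0 := by
  rw [surfaceArea_univ]
  exact mul_ne_zero (by simp) (measure_ball_pos _ _ one_pos).ne'

theorem surfaceArea_lune (P P' : UnitSphere n) :
    surfaceArea n (Subtype.val ⁻¹' lune (P : 𝔼 n) P') =
      ENNReal.ofReal (angle (P : 𝔼 n) P' / Real.pi) * surfaceArea n univ := by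
  rw [surfaceArea_preimage_cone (isOpen_lune _ _).measurableSet fun x hx r hr ↦ smul_mem_lune hx hr,
    volume_lune (norm_eq_of_mem_sphere P) (norm_eq_of_mem_sphere P'), surfaceArea_univ]
  ring

theorem surfaceArea_perp {P : 𝔼 n} (hP : P ≠ 0) :
    ∀ᵐ Q : UnitSphere n ∂surfaceArea n, ⟪P, (Q : 𝔼 n)⟫ ≠ 0 := by
  have hset : {Q : UnitSphere n | ¬ ⟪P, (Q : 𝔼 n)⟫ ≠ 0} =
      Subtype.val ⁻¹' {x : 𝔼 n | ⟪P, x⟫ = 0} := by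
    ext; simp
  rw [ae_iff, hset]
  refine surfaceArea_preimage_cone_eq_zero
    (isClosed_eq (by fun_prop) continuous_const).measurableSet (fun x hx r _ ↦ ?_)
    (volume_perp_eq_zero hP)
  simp only [mem_ofPred_eq, inner_smul_right] at hx ⊢
  rw [hx, mul_zero]

/-! ### Tangential equators -/

/-- Almost no equator is touched from one side: if `Q` is perpendicular to a member of a family of
nonzero vectors, then, off a null set, some member has positive inner product with `Q`. Indeed the
exceptional points lie on the frontier of the convex cone polar to the family. -/
theorem ae_exists_inner_pos {S : Set (𝔼 n)} (hS : ∀ P ∈ S, P ≠ 0) :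
    ∀ᵐ Q : UnitSphere n ∂surfaceArea n, (∃ P ∈ S, ⟪P, (Q : 𝔼 n)⟫ = 0) →
      ∃ P ∈ S, 0 < ⟪P, (Q : 𝔼 n)⟫ := by
  set C : Set (𝔼 n) := {x | ∀ P ∈ S, ⟪P, x⟫ ≤ 0} with hC
  have hconv : Convex ℝ C := by
    intro x hx y hy a b ha hb _ P hP
    rw [inner_add_right, inner_smul_right, inner_smul_right]
    nlinarith [hx P hP, hy P hP]
  have hnull : surfaceArea n (Subtype.val ⁻¹' frontier C) = 0 := by
    refine surfaceArea_preimage_cone_eq_zero isClosed_frontier.measurableSet (fun x hx r hr ↦ ?_)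
      (hconv.addHaar_frontier _)
    have hpre : (Homeomorph.smulOfNeZero r hr.ne' : (𝔼 n) ≃ₜ (𝔼 n)) ⁻¹' C = C := by
      ext y
      simp only [mem_preimage, Homeomorph.smulOfNeZero_apply, hC, mem_ofPred_eq, inner_smul_right]
      exact forall₂_congr fun P _ ↦ ⟨fun h ↦ by by_contra! h'; nlinarith [mul_pos hr h'],
        fun h ↦ mul_nonpos_of_nonneg_of_nonpos hr.le h⟩
    rw [← hpre, ← Homeomorph.preimage_frontier] at hx
    exact hx
  have hae : ∀ᵐ Q : UnitSphere n ∂surfaceArea n, (Q : 𝔼 n) ∉ frontier C :=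
    measure_eq_zero_iff_ae_notMem.1 hnull
  filter_upwards [hae] with Q hQ
  rintro ⟨P, hP, hPQ⟩
  by_contra! hneg
  refine hQ ⟨subset_closure hneg, fun hint ↦ ?_⟩
  -- moving from an interior point in the direction `P` makes the inner product with `P` positive
  have htend : Tendsto (fun ε : ℝ ↦ (Q : 𝔼 n) + ε • P) (𝓝[>] 0) (𝓝 Q) := by
    have : Continuous fun ε : ℝ ↦ (Q : 𝔼 n) + ε • P := by fun_prop
    simpa using (this.tendsto 0).mono_left nhdsWithin_le_nhds
  obtain ⟨ε, hε, hε0⟩ := ((htend.eventually (mem_interior_iff_mem_nhds.1 hint)).and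
    self_mem_nhdsWithin).exists
  have h1 : ⟪P, (Q : 𝔼 n) + ε • P⟫ ≤ 0 := hε P hP
  rw [inner_add_right, hPQ, inner_smul_right, zero_add] at h1
  have h2 : 0 < ⟪P, P⟫ := real_inner_self_pos.2 (hS P hP)
  have h3 : (0 : ℝ) < ε := hε0
  nlinarith [mul_pos h3 h2]

/-- Off a null set, a point on one of the equators of `γ t`, `t ∈ J`, lies strictly on the positive
side of one of them and strictly on the negative side of another. -/
theorem ae_exists_inner_pos_and_neg (γ : ℝ → UnitSphere n) (J : Set ℝ) :
    ∀ᵐ Q : UnitSphere n ∂surfaceArea n, (∃ t ∈ J, Q ∈ equator (γ t)) →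
      (∃ s ∈ J, 0 < ⟪(γ s : 𝔼 n), (Q : 𝔼 n)⟫) ∧ ∃ t ∈ J, ⟪(γ t : 𝔼 n), (Q : 𝔼 n)⟫ < 0 := by
  filter_upwards [ae_exists_inner_pos (S := (fun t ↦ (γ t : 𝔼 n)) '' J)
      (by rintro _ ⟨t, _, rfl⟩; exact ne_zero_of_mem_unit_sphere _),
    ae_exists_inner_pos (S := (fun t ↦ -(γ t : 𝔼 n)) '' J)
      (by rintro _ ⟨t, _, rfl⟩; exact neg_ne_zero.2 (ne_zero_of_mem_unit_sphere _))] with Q h1 h2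
  rintro ⟨t, ht, htQ⟩
  have htQ' : ⟪(γ t : 𝔼 n), (Q : 𝔼 n)⟫ = 0 := htQ
  constructor
  · obtain ⟨_, ⟨s, hs, rfl⟩, h⟩ := h1 ⟨_, ⟨t, ht, rfl⟩, htQ'⟩
    exact ⟨s, hs, h⟩
  · obtain ⟨_, ⟨s, hs, rfl⟩, h⟩ := h2 ⟨_, ⟨t, ht, rfl⟩, by rw [inner_neg_left, htQ', neg_zero]⟩
    exact ⟨s, hs, by simpa [inner_neg_left] using h⟩

end

/-! ### Sign changes along uniform partitions -/

section

theorem exists_mul_neg_of_ne_zero {x : ℕ → ℝ} {N : ℕ} (hx : ∀ i ≤ N, x i ≠ 0)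
    (hpos : ∃ i ≤ N, 0 < x i) (hneg : ∃ i ≤ N, x i < 0) : ∃ i < N, x i * x (i + 1) < 0 := by
  by_contra! h
  have key : ∀ i ≤ N, 0 < x 0 * x i := by
    intro i
    induction i with
    | zero => intro _; exact mul_self_pos.2 (hx 0 (Nat.zero_le _))
    | succ i ih =>
      intro hi
      have h1 := ih (by omega)
      have h2 : 0 < x i * x (i + 1) :=
        lt_of_le_of_ne (h i (by omega)) (mul_ne_zero (hx i (by omega)) (hx _ hi)).symm
      have h3 := mul_pos h1 h2
      have h4 : x 0 * x i * (x i * x (i + 1)) = x i ^ 2 * (x 0 * x (i + 1)) := by ring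
      rw [h4] at h3
      exact pos_of_mul_pos_right h3 (sq_nonneg _)
  obtain ⟨i, hi, hi'⟩ := hpos
  obtain ⟨j, hj, hj'⟩ := hneg
  have h1 := key i hi
  have h2 := key j hj
  rcases lt_or_gt_of_ne (hx 0 (Nat.zero_le _)) with h0 | h0 <;> nlinarith

theorem eventually_exists_node_pos {f : ℝ → ℝ} (hf : ContinuousOn f (Icc 0 1)) {u : ℝ}
    (hu : u ∈ Icc (0 : ℝ) 1) (hpos : 0 < f u) :
    ∀ᶠ N : ℕ in atTop, ∃ i ≤ N, 0 < f (i / N) := by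
  have hle : ∀ N : ℕ, ⌊u * N⌋₊ ≤ N := fun N ↦ by
    refine Nat.floor_le_of_le ?_
    nlinarith [hu.2, (Nat.cast_nonneg N : (0 : ℝ) ≤ N)]
  have hlim : Tendsto (fun N : ℕ ↦ (⌊u * N⌋₊ : ℝ) / N) atTop (𝓝[Icc 0 1] u) := by
    refine tendsto_nhdsWithin_iff.2
      ⟨(tendsto_nat_floor_mul_div_atTop hu.1).comp tendsto_natCast_atTop_atTop, ?_⟩
    filter_upwards [eventually_gt_atTop 0] with N hN
    have hN' : (0 : ℝ) < N := by exact_mod_cast hN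
    exact ⟨by positivity, by rw [div_le_one hN']; exact_mod_cast hle N⟩
  filter_upwards [((hf u hu).tendsto.comp hlim).eventually (lt_mem_nhds hpos)] with N hN
  exact ⟨_, hle N, hN⟩

/-- A continuous function on `[0, 1]` which takes both signs but vanishes at no node changes sign
between two neighbours in every sufficiently fine uniform partition. -/
theorem eventually_exists_sign_change {f : ℝ → ℝ} (hf : ContinuousOn f (Icc 0 1))
    (h0 : ∀ N : ℕ, ∀ i : ℕ, f (i / N) ≠ 0) (hpos : ∃ u ∈ Icc (0 : ℝ) 1, 0 < f u)
    (hneg : ∃ u ∈ Icc (0 : ℝ) 1, f u < 0) :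
    ∀ᶠ N : ℕ in atTop, ∃ i < N, f (i / N) * f ((i + 1 : ℕ) / N) < 0 := by
  obtain ⟨u, hu, hu'⟩ := hpos
  obtain ⟨v, hv, hv'⟩ := hneg
  filter_upwards [eventually_exists_node_pos hf hu hu',
    eventually_exists_node_pos hf.neg hv (neg_pos.2 hv')] with N h1 h2
  exact exists_mul_neg_of_ne_zero (x := fun i : ℕ ↦ f (i / N)) (fun i _ ↦ h0 N i) h1
    (by simpa using h2)

end

section

variable {n : ℕ}

local notation "𝔼" n => EuclideanSpace ℝ (Fin (n + 1))

/-! ### The area covered by the equators of an arc -/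

/-- The union of the equators of `γ t`, where `t` runs over `J`. -/
def hitSet (γ : ℝ → UnitSphere n) (J : Set ℝ) : Set (UnitSphere n) :=
  {Q | ∃ t ∈ J, Q ∈ equator (γ t)}

theorem hitSet_mono (γ : ℝ → UnitSphere n) {J K : Set ℝ} (h : J ⊆ K) :
    hitSet γ J ⊆ hitSet γ K := fun _ ⟨t, ht, hQ⟩ ↦ ⟨t, h ht, hQ⟩

theorem isClosed_hitSet {γ : ℝ → UnitSphere n} {J : Set ℝ} (hJ : IsCompact J)
    (hγ : ContinuousOn γ J) : IsClosed (hitSet γ J) := by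
  have hc : ContinuousOn (fun p : ℝ × UnitSphere n ↦ ⟪(γ p.1 : 𝔼 n), (p.2 : 𝔼 n)⟫)
      (J ×ˢ univ) := by
    have h1 : ContinuousOn (fun p : ℝ × UnitSphere n ↦ (γ p.1 : 𝔼 n)) (J ×ˢ univ) :=
      continuous_subtype_val.comp_continuousOn
        (hγ.comp continuousOn_fst fun p hp ↦ hp.1)
    exact h1.inner (𝕜 := ℝ) (continuous_subtype_val.comp continuous_snd).continuousOn
  have hcl := hc.preimage_isClosed_of_isClosed (hJ.isClosed.prod isClosed_univ)
    (isClosed_singleton (x := (0 : ℝ)))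
  have hcomp := (hJ.prod isCompact_univ).of_isClosed_subset hcl inter_subset_left
  convert (hcomp.image continuous_snd).isClosed using 1
  ext Q
  constructor
  · rintro ⟨t, ht, hQ⟩
    exact ⟨(t, Q), ⟨⟨ht, mem_univ _⟩, hQ⟩, rfl⟩
  · rintro ⟨⟨t, Q'⟩, ⟨⟨ht, _⟩, hQ⟩, rfl⟩
    exact ⟨t, ht, hQ⟩

theorem edist_eq_ofReal_norm_sub (P P' : 𝔼 n) : edist P P' = ENNReal.ofReal ‖P - P'‖ := by
  rw [edist_dist, dist_eq_norm]

theorem surfaceArea_lune_mul_pi (P P' : UnitSphere n) :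
    surfaceArea n (Subtype.val ⁻¹' lune (P : 𝔼 n) P') * ENNReal.ofReal Real.pi =
      surfaceArea n univ * ENNReal.ofReal (angle (P : 𝔼 n) P') := by
  rw [surfaceArea_lune, mul_right_comm, ← ENNReal.ofReal_mul
    (div_nonneg (angle_nonneg _ _) Real.pi_pos.le), div_mul_cancel₀ _ Real.pi_ne_zero, mul_comm]

theorem edist_le_surfaceArea_lune (P P' : UnitSphere n) :
    surfaceArea n univ * edist (P : 𝔼 n) P' ≤
      surfaceArea n (Subtype.val ⁻¹' lune (P : 𝔼 n) P') * ENNReal.ofReal Real.pi := by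
  rw [surfaceArea_lune_mul_pi, edist_eq_ofReal_norm_sub]
  gcongr
  exact norm_sub_le_angle (norm_eq_of_mem_sphere P) (norm_eq_of_mem_sphere P')

theorem surfaceArea_lune_le_edist {P P' : UnitSphere n} {δ : ℝ} (hδ : dist P P' ≤ δ) :
    surfaceArea n (Subtype.val ⁻¹' lune (P : 𝔼 n) P') * ENNReal.ofReal Real.pi *
        ENNReal.ofReal (1 - δ ^ 2) ≤ surfaceArea n univ * edist (P : 𝔼 n) P' := by
  rw [surfaceArea_lune_mul_pi, edist_eq_ofReal_norm_sub, mul_assoc,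
    ← ENNReal.ofReal_mul (angle_nonneg _ _)]
  gcongr
  refine le_trans ?_ (angle_mul_le_norm_sub (norm_eq_of_mem_sphere P) (norm_eq_of_mem_sphere P'))
  have : ‖(P : 𝔼 n) - P'‖ ≤ δ := by rw [← dist_eq_norm]; exact hδ
  have h0 := angle_nonneg (P : 𝔼 n) P'
  gcongr

/-- The `i`-th node of the partition of `[a, b]` into `N` equal parts. -/
noncomputable def node (a b : ℝ) (N i : ℕ) : ℝ := a + (b - a) * (i / N)

theorem node_mem {a b : ℝ} (hab : a ≤ b) {N i : ℕ} (hi : i ≤ N) : node a b N i ∈ Icc a b := by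
  have h1 : (i : ℝ) / N ≤ 1 := div_le_one_of_le₀ (by exact_mod_cast hi) (Nat.cast_nonneg _)
  have h0 : 0 ≤ (i : ℝ) / N := by positivity
  constructor <;> unfold node <;> nlinarith

theorem node_mono {a b : ℝ} (hab : a ≤ b) (N : ℕ) : Monotone (node a b N) := by
  intro i j hij
  have : (0 : ℝ) ≤ b - a := by linarith
  unfold node
  gcongr

/-- The part of the sphere covered by the lunes between consecutive nodes. -/
def luneUnion (γ : ℝ → UnitSphere n) (a b : ℝ) (N : ℕ) : Set (UnitSphere n) :=
  ⋃ i ∈ Finset.range N,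
    Subtype.val ⁻¹' lune (γ (node a b N i) : 𝔼 n) (γ (node a b N (i + 1)) : 𝔼 n)

theorem surfaceArea_luneUnion_le {γ : ℝ → UnitSphere n} {a b : ℝ} (hab : a ≤ b) {N : ℕ} {δ : ℝ}
    (h : ∀ i < N, dist (γ (node a b N i)) (γ (node a b N (i + 1))) ≤ δ) :
    surfaceArea n (luneUnion γ a b N) * ENNReal.ofReal Real.pi * ENNReal.ofReal (1 - δ ^ 2) ≤
      surfaceArea n univ * curveLength γ (Icc a b) := by
  calc _ ≤ (∑ i ∈ Finset.range N, surfaceArea n (Subtype.val ⁻¹'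
        lune (γ (node a b N i) : 𝔼 n) (γ (node a b N (i + 1)) : 𝔼 n))) *
          ENNReal.ofReal Real.pi * ENNReal.ofReal (1 - δ ^ 2) := by
        gcongr
        exact measure_biUnion_finset_le _ _
    _ ≤ ∑ i ∈ Finset.range N, surfaceArea n univ *
        edist (γ (node a b N i) : 𝔼 n) (γ (node a b N (i + 1)) : 𝔼 n) := by
        rw [Finset.sum_mul, Finset.sum_mul]
        exact Finset.sum_le_sum fun i hi ↦ surfaceArea_lune_le_edist (h i (Finset.mem_range.1 hi))
    _ ≤ _ := by
        rw [← Finset.mul_sum]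
        gcongr
        rw [Finset.sum_congr rfl fun i _ ↦ edist_comm (γ (node a b N i) : 𝔼 n) _]
        exact eVariationOn.sum_le_of_monotoneOn_Iic ((node_mono hab N).monotoneOn _)
          fun i hi ↦ node_mem hab hi

theorem eventually_dist_node_le {γ : ℝ → UnitSphere n} {a b : ℝ} (hab : a ≤ b)
    (hγ : ContinuousOn γ (Icc a b)) {δ : ℝ} (hδ : 0 < δ) :
    ∀ᶠ N : ℕ in atTop, ∀ i < N, dist (γ (node a b N i)) (γ (node a b N (i + 1))) ≤ δ := by
  obtain ⟨η, hη, h⟩ := Metric.uniformContinuousOn_iff.1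
    (isCompact_Icc.uniformContinuousOn_of_continuous hγ) δ hδ
  have hlim : Tendsto (fun N : ℕ ↦ (b - a) / N) atTop (𝓝 0) :=
    tendsto_const_div_atTop_nhds_zero_nat _
  filter_upwards [hlim.eventually (gt_mem_nhds hη)] with N hN i hi
  refine (h _ (node_mem hab hi.le) _ (node_mem hab hi) ?_).le
  have : node a b N i - node a b N (i + 1) = -((b - a) / N) := by
    unfold node; push_cast; ring
  rw [Real.dist_eq, this, abs_neg, abs_of_nonneg (div_nonneg (by linarith) (Nat.cast_nonneg _))]
  exact hN

theorem ae_mem_luneUnion {γ : ℝ → UnitSphere n} {a b : ℝ} (hγ : ContinuousOn γ (Icc a b)) :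
    ∀ᵐ Q : UnitSphere n ∂surfaceArea n, Q ∈ hitSet γ (Icc a b) →
      ∀ᶠ N : ℕ in atTop, Q ∈ luneUnion γ a b N := by
  have hnode : ∀ᵐ Q : UnitSphere n ∂surfaceArea n, ∀ N i : ℕ,
      ⟪(γ (node a b N i) : 𝔼 n), (Q : 𝔼 n)⟫ ≠ 0 :=
    ae_all_iff.2 fun N ↦ ae_all_iff.2 fun i ↦ surfaceArea_perp (ne_zero_of_mem_unit_sphere _)
  filter_upwards [hnode, ae_exists_inner_pos_and_neg γ (Icc a b)] with Q hQ hQ' hhit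
  obtain ⟨⟨s, hs, hs'⟩, t, ht, ht'⟩ := hQ' hhit
  have hab : a < b := by
    by_contra! hba
    -- a degenerate interval leaves no room for two signs
    have : s = t := by linarith [hs.1, hs.2, ht.1, ht.2]
    rw [this] at hs'
    linarith
  have hab' : 0 < b - a := by linarith
  set f : ℝ → ℝ := fun u ↦ ⟪(γ (a + (b - a) * u) : 𝔼 n), (Q : 𝔼 n)⟫ with hf
  have hmaps : MapsTo (fun u ↦ a + (b - a) * u) (Icc 0 1) (Icc a b) := fun u hu ↦ by
    constructor <;> nlinarith [hu.1, hu.2]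
  have hcont : ContinuousOn f (Icc 0 1) := by
    have h1 : ContinuousOn (fun u ↦ (γ (a + (b - a) * u) : 𝔼 n)) (Icc 0 1) :=
      continuous_subtype_val.comp_continuousOn (hγ.comp (by fun_prop) hmaps)
    exact h1.inner (𝕜 := ℝ) continuousOn_const
  have hparam : ∀ s ∈ Icc a b, (s - a) / (b - a) ∈ Icc (0 : ℝ) 1 ∧
      a + (b - a) * ((s - a) / (b - a)) = s := fun s hs ↦ by
    refine ⟨⟨div_nonneg (by linarith [hs.1]) hab'.le, ?_⟩, ?_⟩
    · rw [div_le_one hab']; linarith [hs.2]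
    · rw [mul_div_cancel₀ _ hab'.ne']; ring
  have hev := eventually_exists_sign_change hcont (fun N i ↦ hQ N i)
    ⟨_, (hparam s hs).1, by rw [hf]; simp only [(hparam s hs).2]; exact hs'⟩
    ⟨_, (hparam t ht).1, by rw [hf]; simp only [(hparam t ht).2]; exact ht'⟩
  filter_upwards [hev] with N hN
  obtain ⟨i, hi, h⟩ := hN
  exact mem_biUnion (Finset.mem_coe.2 (Finset.mem_range.2 hi)) h

/-- The equators of a compact arc cover an area of at most `length / π` times the whole area. -/
theorem surfaceArea_hitSet_Icc_le {γ : ℝ → UnitSphere n} {a b : ℝ} (hab : a ≤ b)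
    (hγ : ContinuousOn γ (Icc a b)) :
    surfaceArea n (hitSet γ (Icc a b)) * ENNReal.ofReal Real.pi ≤
      surfaceArea n univ * curveLength γ (Icc a b) := by
  -- the points lying in all the unions of lunes from the `M`-th on
  set C : ℕ → Set (UnitSphere n) := fun M ↦ ⋂ N ≥ M, luneUnion γ a b N with hC
  have hCmono : Monotone C := fun M M' hM ↦
    biInter_subset_biInter_left fun N (hN : M' ≤ N) ↦ hM.trans hN
  have hsub : surfaceArea n (hitSet γ (Icc a b)) ≤ ⨆ M, surfaceArea n (C M) := by
    rw [← hCmono.measure_iUnion]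
    refine measure_mono_ae ?_
    filter_upwards [ae_mem_luneUnion hγ] with Q hQ hmem
    obtain ⟨M, hM⟩ := eventually_atTop.1 (hQ hmem)
    exact mem_iUnion.2 ⟨M, mem_iInter₂.2 hM⟩
  have hbound : ∀ δ : ℝ, 0 < δ → surfaceArea n (hitSet γ (Icc a b)) * ENNReal.ofReal Real.pi *
      ENNReal.ofReal (1 - δ ^ 2) ≤ surfaceArea n univ * curveLength γ (Icc a b) := by
    intro δ hδ
    refine (mul_le_mul_left (mul_le_mul_left hsub _) _).trans ?_
    rw [ENNReal.iSup_mul, ENNReal.iSup_mul]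
    refine iSup_le fun M ↦ ?_
    obtain ⟨N, hN, hMN⟩ := ((eventually_dist_node_le hab hγ hδ).and (eventually_ge_atTop M)).exists
    refine le_trans ?_ (surfaceArea_luneUnion_le hab hN)
    gcongr
    exact biInter_subset_of_mem (t := luneUnion γ a b) hMN
  have hlim : Tendsto (fun δ : ℝ ↦ surfaceArea n (hitSet γ (Icc a b)) * ENNReal.ofReal Real.pi *
      ENNReal.ofReal (1 - δ ^ 2)) (𝓝[>] 0)
      (𝓝 (surfaceArea n (hitSet γ (Icc a b)) * ENNReal.ofReal Real.pi * 1)) := by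
    refine ENNReal.Tendsto.const_mul ?_ (Or.inl one_ne_zero)
    have : Continuous fun δ : ℝ ↦ ENNReal.ofReal (1 - δ ^ 2) :=
      ENNReal.continuous_ofReal.comp (by fun_prop)
    simpa using (this.tendsto 0).mono_left nhdsWithin_le_nhds
  rw [mul_one] at hlim
  refine le_of_tendsto hlim ?_
  filter_upwards [self_mem_nhdsWithin] with δ hδ using hbound δ hδ

end

/-! ### The area covered by the equators over an interval -/

section

/-- A set of reals has a countable subset which is both cofinal and coinitial. -/
theorem exists_countable_cofinal_coinitial (J : Set ℝ) :
    ∃ D ⊆ J, D.Countable ∧ ∀ t ∈ J, ∃ s ∈ D, ∃ s' ∈ D, s ≤ t ∧ t ≤ s' := by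
  obtain ⟨D, hD, hdense⟩ := TopologicalSpace.exists_countable_dense J
  have hmem : ∀ U : Set ℝ, IsOpen U → (J ∩ U).Nonempty → ∃ d ∈ Subtype.val '' D, d ∈ U := by
    rintro U hU ⟨x, hxJ, hxU⟩
    obtain ⟨d, hdU, hdD⟩ := hdense.exists_mem_open (hU.preimage continuous_subtype_val)
      ⟨⟨x, hxJ⟩, hxU⟩
    exact ⟨d, ⟨d, hdU, rfl⟩, hdD⟩
  -- a dense subset can only miss the end points of `J`
  refine ⟨Subtype.val '' D ∪ ({t | IsGreatest J t} ∪ {t | IsLeast J t}), ?_, ?_, fun t ht ↦ ?_⟩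
  · rintro x (⟨d, _, rfl⟩ | hx | hx)
    · exact d.2
    · exact hx.1
    · exact hx.1
  · refine (hD.image _).union (Set.Subsingleton.countable ?_ |>.union
      (Set.Subsingleton.countable ?_))
    · exact fun x hx y hy ↦ IsGreatest.unique hx hy
    · exact fun x hx y hy ↦ IsLeast.unique hx hy
  · have hlow : ∃ s ∈ Subtype.val '' D ∪ ({t | IsGreatest J t} ∪ {t | IsLeast J t}), s ≤ t := by
      by_cases h : IsLeast J t
      · exact ⟨t, Or.inr (Or.inr h), le_rfl⟩
      · obtain ⟨x, hx, hxt⟩ : ∃ x ∈ J, x < t := by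
          by_contra! h'
          exact h ⟨ht, h'⟩
        obtain ⟨d, hd, hdt⟩ := hmem (Iio t) isOpen_Iio ⟨x, hx, hxt⟩
        exact ⟨d, Or.inl hd, le_of_lt hdt⟩
    have hupp : ∃ s ∈ Subtype.val '' D ∪ ({t | IsGreatest J t} ∪ {t | IsLeast J t}), t ≤ s := by
      by_cases h : IsGreatest J t
      · exact ⟨t, Or.inr (Or.inl h), le_rfl⟩
      · obtain ⟨x, hx, hxt⟩ : ∃ x ∈ J, t < x := by
          by_contra! h'
          exact h ⟨ht, h'⟩
        obtain ⟨d, hd, hdt⟩ := hmem (Ioi t) isOpen_Ioi ⟨x, hx, hxt⟩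
        exact ⟨d, Or.inl hd, le_of_lt hdt⟩
    obtain ⟨s, hs, hst⟩ := hlow
    obtain ⟨s', hs', hst'⟩ := hupp
    exact ⟨s, hs, s', hs', hst, hst'⟩

end

section

variable {n : ℕ}

local notation "𝔼" n => EuclideanSpace ℝ (Fin (n + 1))

variable {γ : ℝ → UnitSphere n} {J I : Set ℝ}

/-- The hit set of an interval is a countable directed union of hit sets of compact intervals
contained in it. -/
theorem exists_hitSet_eq_iUnion (hJ : J.OrdConnected) (γ : ℝ → UnitSphere n) :
    ∃ D : Set (ℝ × ℝ), D.Countable ∧ (∀ p ∈ D, p.1 ≤ p.2 ∧ Icc p.1 p.2 ⊆ J) ∧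
      hitSet γ J = ⋃ p : D, hitSet γ (Icc p.1.1 p.1.2) ∧
      Directed (· ⊆ ·) fun p : D ↦ hitSet γ (Icc p.1.1 p.1.2) := by
  obtain ⟨D, hDJ, hD, hcof⟩ := exists_countable_cofinal_coinitial J
  refine ⟨{p ∈ D ×ˢ D | p.1 ≤ p.2}, (hD.prod hD).mono (sep_subset _ _),
    fun p hp ↦ ⟨hp.2, hJ.out (hDJ hp.1.1) (hDJ hp.1.2)⟩, ?_, ?_⟩
  · ext Q
    simp only [mem_iUnion]
    constructor
    · rintro ⟨t, ht, hQ⟩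
      obtain ⟨s, hs, s', hs', h1, h2⟩ := hcof t ht
      exact ⟨⟨(s, s'), ⟨hs, hs'⟩, h1.trans h2⟩, t, ⟨h1, h2⟩, hQ⟩
    · rintro ⟨⟨p, hp⟩, hQ⟩
      exact hitSet_mono γ (hJ.out (hDJ hp.1.1) (hDJ hp.1.2)) hQ
  · rintro ⟨p, hp⟩ ⟨q, hq⟩
    refine ⟨⟨(min p.1 q.1, max p.2 q.2), ⟨?_, ?_⟩, ?_⟩, hitSet_mono γ ?_, hitSet_mono γ ?_⟩
    · rcases min_choice p.1 q.1 with h | h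
      · simpa only [h] using hp.1.1
      · simpa only [h] using hq.1.1
    · rcases max_choice p.2 q.2 with h | h
      · simpa only [h] using hp.1.2
      · simpa only [h] using hq.1.2
    · exact (min_le_left _ _).trans (hp.2.trans (le_max_left _ _))
    · exact Icc_subset_Icc (min_le_left _ _) (le_max_left _ _)
    · exact Icc_subset_Icc (min_le_right _ _) (le_max_right _ _)

theorem measurableSet_hitSet (hJ : J.OrdConnected) (hγ : ContinuousOn γ J) :
    MeasurableSet (hitSet γ J) := by
  obtain ⟨D, hD, hDJ, h, -⟩ := exists_hitSet_eq_iUnion hJ γ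
  have := hD.to_subtype
  rw [h]
  exact MeasurableSet.iUnion fun p ↦
    (isClosed_hitSet isCompact_Icc (hγ.mono (hDJ p.1 p.2).2)).measurableSet

theorem surfaceArea_hitSet_le (hJ : J.OrdConnected) (hγ : ContinuousOn γ J) :
    surfaceArea n (hitSet γ J) * ENNReal.ofReal Real.pi ≤
      surfaceArea n univ * curveLength γ J := by
  obtain ⟨D, hD, hDJ, h, hdir⟩ := exists_hitSet_eq_iUnion hJ γ
  have := hD.to_subtype
  rw [h, hdir.measure_iUnion, ENNReal.iSup_mul]
  refine iSup_le fun p ↦ (surfaceArea_hitSet_Icc_le (hDJ p.1 p.2).1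
    (hγ.mono (hDJ p.1 p.2).2)).trans ?_
  gcongr
  exact eVariationOn.mono _ (hDJ p.1 p.2).2

/-! ### Counting the cells of a grid -/

/-- The part of `I` in the `j`-th cell of the grid of mesh `1 / k`. -/
def cell (I : Set ℝ) (k : ℕ) (j : ℤ) : Set ℝ := {t ∈ I | ⌊(k : ℝ) * t⌋ = j}

theorem floor_mul_mono (k : ℕ) : Monotone fun t : ℝ ↦ ⌊(k : ℝ) * t⌋ := fun _ _ h ↦
  Int.floor_mono (mul_le_mul_of_nonneg_left h (Nat.cast_nonneg k))

theorem ordConnected_cell (hI : I.OrdConnected) (k : ℕ) (j : ℤ) : (cell I k j).OrdConnected := by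
  refine ⟨fun x hx y hy z hz ↦ ⟨hI.out hx.1 hy.1 hz, le_antisymm ?_ ?_⟩⟩
  · rw [← hy.2]; exact floor_mul_mono k hz.2
  · rw [← hx.2]; exact floor_mul_mono k hz.1

theorem sum_curveLength_cell_le (γ : ℝ → UnitSphere n) (I : Set ℝ) (k : ℕ) (F : Finset ℤ) :
    ∑ j ∈ F, curveLength γ (cell I k j) ≤ curveLength γ {t ∈ I | ⌊(k : ℝ) * t⌋ ∈ F} := by
  induction F using Finset.induction_on_max with
  | empty => simp
  | insert a s hs ih =>
    rw [Finset.sum_insert fun h ↦ (hs a h).false, add_comm]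
    refine (add_le_add_left ih _).trans ?_
    refine (eVariationOn.add_le_union _ ?_).trans (eVariationOn.mono _ ?_)
    · rintro x ⟨_, hx⟩ y ⟨_, hy⟩
      by_contra! hlt
      have h1 := floor_mul_mono k hlt.le
      have h2 := hs _ hx
      simp only at h1
      omega
    · rintro x (⟨hx, h⟩ | ⟨hx, h⟩)
      · exact ⟨hx, Finset.mem_insert_of_mem h⟩
      · exact ⟨hx, Finset.mem_insert.2 (Or.inl h)⟩

/-- The number of cells of mesh `1 / k` in which the equator of `γ t` passes through `Q`. -/
noncomputable def cellCount (γ : ℝ → UnitSphere n) (I : Set ℝ) (k : ℕ) (Q : UnitSphere n) :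
    ℝ≥0∞ :=
  ∑' j : ℤ, (hitSet γ (cell I k j)).indicator 1 Q

/-- The cell count is the number of cells that contain a zero of `⟪γ t, Q⟫`. -/
theorem cellCount_eq (γ : ℝ → UnitSphere n) (I : Set ℝ) (k : ℕ) (Q : UnitSphere n) :
    cellCount γ I k Q =
      (((fun t : ℝ ↦ ⌊(k : ℝ) * t⌋) '' {t ∈ I | Q ∈ equator (γ t)}).encard : ℝ≥0∞) := by
  rw [← Measure.count_apply (MeasurableSet.of_discrete), ← lintegral_indicator_one
    (MeasurableSet.of_discrete), lintegral_count, cellCount]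
  refine tsum_congr fun j ↦ ?_
  have : Q ∈ hitSet γ (cell I k j) ↔
      j ∈ (fun t : ℝ ↦ ⌊(k : ℝ) * t⌋) '' {t ∈ I | Q ∈ equator (γ t)} :=
    ⟨fun ⟨t, ht, hQ⟩ ↦ ⟨t, ⟨ht.1, hQ⟩, ht.2⟩, fun ⟨t, ht, hj⟩ ↦ ⟨t, ⟨ht.1, hj⟩, ht.2⟩⟩
  by_cases h : Q ∈ hitSet γ (cell I k j)
  · rw [indicator_of_mem h, indicator_of_mem (this.1 h)]; rfl
  · rw [indicator_of_notMem h, indicator_of_notMem (fun h' ↦ h (this.2 h'))]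

theorem measurable_cellCount (hI : I.OrdConnected) (hγ : ContinuousOn γ I) (k : ℕ) :
    Measurable (cellCount γ I k) :=
  Measurable.tsum fun j ↦ measurable_one.indicator
    (measurableSet_hitSet (ordConnected_cell hI k j) (hγ.mono (sep_subset _ _)))

theorem lintegral_cellCount_le (hI : I.OrdConnected) (hγ : ContinuousOn γ I) (k : ℕ) :
    (∫⁻ Q, cellCount γ I k Q ∂surfaceArea n) * ENNReal.ofReal Real.pi ≤
      surfaceArea n univ * curveLength γ I := by
  have hc : ∀ j, ContinuousOn γ (cell I k j) := fun j ↦ hγ.mono (sep_subset _ _)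
  have hm : ∀ j, MeasurableSet (hitSet γ (cell I k j)) := fun j ↦
    measurableSet_hitSet (ordConnected_cell hI k j) (hc j)
  simp only [cellCount]
  rw [lintegral_tsum fun j ↦ (measurable_one.indicator (hm j)).aemeasurable]
  simp only [lintegral_indicator_one (hm _)]
  rw [← ENNReal.tsum_mul_right, ENNReal.tsum_eq_iSup_sum]
  refine iSup_le fun F ↦ ?_
  calc _ ≤ ∑ j ∈ F, surfaceArea n univ * curveLength γ (cell I k j) :=
        Finset.sum_le_sum fun j _ ↦ surfaceArea_hitSet_le (ordConnected_cell hI k j) (hc j)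
    _ ≤ _ := by
        rw [← Finset.mul_sum]
        gcongr
        exact (sum_curveLength_cell_le γ I k F).trans (eVariationOn.mono _ (sep_subset _ _))

theorem cellCount_le_multiplicity (γ : ℝ → UnitSphere n) (I : Set ℝ) (k : ℕ) (Q : UnitSphere n) :
    cellCount γ I k Q ≤ multiplicity γ I Q := by
  rw [cellCount_eq, multiplicity]
  exact ENat.toENNReal_le.2 (encard_image_le _ _)

/-- Finitely many reals lie in different cells of every sufficiently fine grid. -/
theorem eventually_injOn_floor (F : Finset ℝ) :
    ∀ᶠ k : ℕ in atTop, InjOn (fun t : ℝ ↦ ⌊(k : ℝ) * t⌋) F := by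
  have h : ∀ s ∈ F, ∀ t ∈ F, ∀ᶠ k : ℕ in atTop, ⌊(k : ℝ) * s⌋ = ⌊(k : ℝ) * t⌋ → s = t := by
    intro s _ t _
    by_cases hst : s = t
    · exact Eventually.of_forall fun _ _ ↦ hst
    have hpos : 0 < |s - t| := abs_pos.2 (sub_ne_zero.2 hst)
    filter_upwards [eventually_ge_atTop ⌈|s - t|⁻¹⌉₊] with k hk hfl
    have h1 : |s - t|⁻¹ ≤ k := (Nat.le_ceil _).trans (by exact_mod_cast hk)
    have h2 := Int.abs_sub_lt_one_of_floor_eq_floor hfl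
    rw [← mul_sub, abs_mul, Nat.abs_cast] at h2
    rw [inv_le_iff_one_le_mul₀ hpos] at h1
    linarith
  have h' := (Finset.eventually_all F).2 fun s hs ↦
    (Finset.eventually_all F).2 fun t ht ↦ h s hs t ht
  filter_upwards [h'] with k hk s hs t ht hst using hk s hs t ht hst

theorem multiplicity_le_liminf (γ : ℝ → UnitSphere n) (I : Set ℝ) (Q : UnitSphere n) :
    multiplicity γ I Q ≤ liminf (fun k ↦ cellCount γ I k Q) atTop := by
  set Z := {t ∈ I | Q ∈ equator (γ t)} with hZ
  refine le_of_forall_lt fun c hc ↦ ?_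
  obtain ⟨F, hFZ, hF⟩ : ∃ F : Finset ℝ, (F : Set ℝ) ⊆ Z ∧ c < (F.card : ℝ≥0∞) := by
    by_cases hfin : Z.Finite
    · refine ⟨hfin.toFinset, by simp, ?_⟩
      rwa [multiplicity, ← hZ, hfin.encard_eq_coe_toFinset_card] at hc
    · obtain ⟨m, hm⟩ := ENNReal.exists_nat_gt (ne_top_of_lt hc)
      obtain ⟨F, hF, hcard⟩ := Set.Infinite.exists_subset_card_eq hfin m
      exact ⟨F, hF, by rwa [hcard]⟩
  refine hF.trans_le (le_liminf_of_le (by isBoundedDefault) ?_)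
  filter_upwards [eventually_injOn_floor F] with k hk
  rw [cellCount_eq]
  have h1 : ((F : Set ℝ).encard : ℝ≥0∞) ≤
      (((fun t : ℝ ↦ ⌊(k : ℝ) * t⌋) '' Z).encard : ℝ≥0∞) := by
    rw [← hk.encard_image]
    exact ENat.toENNReal_le.2 (encard_le_encard (image_mono hFZ))
  simpa using h1

theorem multiplicity_eq_liminf (γ : ℝ → UnitSphere n) (I : Set ℝ) :
    multiplicity γ I = fun Q ↦ liminf (fun k ↦ cellCount γ I k Q) atTop := by
  funext Q
  refine le_antisymm (multiplicity_le_liminf γ I Q) ?_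
  refine (liminf_le_liminf (Eventually.of_forall fun k ↦
    cellCount_le_multiplicity γ I k Q)).trans ?_
  simp

theorem measurable_multiplicity (hI : I.OrdConnected) (hγ : ContinuousOn γ I) :
    Measurable (multiplicity γ I) := by
  rw [multiplicity_eq_liminf]
  exact Measurable.liminf fun k ↦ measurable_cellCount hI hγ k

theorem lintegral_multiplicity_le (hI : I.OrdConnected) (hγ : ContinuousOn γ I) :
    (∫⁻ Q, multiplicity γ I Q ∂surfaceArea n) * ENNReal.ofReal Real.pi ≤
      surfaceArea n univ * curveLength γ I := by
  have hpi : ENNReal.ofReal Real.pi ≠ 0 := by simp [Real.pi_pos]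
  rw [← ENNReal.le_div_iff_mul_le (Or.inl hpi) (Or.inl ENNReal.ofReal_ne_top),
    multiplicity_eq_liminf]
  refine (lintegral_liminf_le fun k ↦ measurable_cellCount hI hγ k).trans ?_
  refine liminf_le_of_frequently_le' (Frequently.of_forall fun k ↦ ?_)
  rw [ENNReal.le_div_iff_mul_le (Or.inl hpi) (Or.inl ENNReal.ofReal_ne_top)]
  exact lintegral_cellCount_le hI hγ k

/-! ### The lower bound and the integral of the multiplicity -/

/-- Each sign change over an inscribed chord forces a zero in the corresponding open parameter
interval, and these intervals are disjoint. -/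
theorem sum_indicator_lune_le (hI : I.OrdConnected) (hγ : ContinuousOn γ I) {u : ℕ → ℝ}
    (hu : Monotone u) (huI : ∀ i, u i ∈ I) (N : ℕ) (Q : UnitSphere n) :
    ∑ i ∈ Finset.range N, (Subtype.val ⁻¹' lune (γ (u i) : 𝔼 n) (γ (u (i + 1)) : 𝔼 n)).indicator
      (1 : UnitSphere n → ℝ≥0∞) Q ≤ multiplicity γ I Q := by
  classical
  set G := (Finset.range N).filter fun i ↦
    (Q : 𝔼 n) ∈ lune (γ (u i) : 𝔼 n) (γ (u (i + 1)) : 𝔼 n) with hG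
  have hsum : ∑ i ∈ Finset.range N, (Subtype.val ⁻¹' lune (γ (u i) : 𝔼 n)
      (γ (u (i + 1)) : 𝔼 n)).indicator (1 : UnitSphere n → ℝ≥0∞) Q = (G.card : ℝ≥0∞) := by
    rw [hG, Finset.card_filter, Nat.cast_sum]
    refine Finset.sum_congr rfl fun i _ ↦ ?_
    by_cases h : (Q : 𝔼 n) ∈ lune (γ (u i) : 𝔼 n) (γ (u (i + 1)) : 𝔼 n) <;> simp [h]
  have hzero : ∀ i ∈ G, ∃ t ∈ Ioo (u i) (u (i + 1)), ⟪(γ t : 𝔼 n), (Q : 𝔼 n)⟫ = 0 := by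
    intro i hi
    have hmem : ⟪(γ (u i) : 𝔼 n), (Q : 𝔼 n)⟫ * ⟪(γ (u (i + 1)) : 𝔼 n), (Q : 𝔼 n)⟫ < 0 :=
      (Finset.mem_filter.1 hi).2
    have hle : u i ≤ u (i + 1) := hu (Nat.le_succ i)
    have hcont : ContinuousOn (fun t ↦ ⟪(γ t : 𝔼 n), (Q : 𝔼 n)⟫) (Icc (u i) (u (i + 1))) :=
      (continuous_subtype_val.comp_continuousOn
        (hγ.mono (hI.out (huI i) (huI (i + 1))))).inner (𝕜 := ℝ) continuousOn_const
    rcases mul_neg_iff.1 hmem with ⟨h1, h2⟩ | ⟨h1, h2⟩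
    · exact intermediate_value_Ioo' hle hcont ⟨h2, h1⟩
    · exact intermediate_value_Ioo hle hcont ⟨h1, h2⟩
  choose! z hz hz0 using hzero
  have hinj : InjOn z G := by
    intro i hi j hj hij
    by_contra hne
    rcases lt_or_gt_of_ne hne with h | h
    · have := hu (show i + 1 ≤ j from h)
      linarith [(hz i hi).2, (hz j hj).1]
    · have := hu (show j + 1 ≤ i from h)
      linarith [(hz j hj).2, (hz i hi).1]
  have hsub : z '' G ⊆ {t ∈ I | Q ∈ equator (γ t)} := by
    rintro _ ⟨i, hi, rfl⟩
    exact ⟨hI.out (huI i) (huI (i + 1)) (Ioo_subset_Icc_self (hz i hi)), hz0 i hi⟩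
  have h1 : ((G : Set ℕ).encard : ℝ≥0∞) ≤ multiplicity γ I Q := by
    rw [← hinj.encard_image, multiplicity]
    exact ENat.toENNReal_le.2 (encard_le_encard hsub)
  rw [hsum]
  simpa using h1

theorem le_lintegral_multiplicity (hI : I.OrdConnected) (hγ : ContinuousOn γ I) :
    surfaceArea n univ * curveLength γ I ≤
      (∫⁻ Q, multiplicity γ I Q ∂surfaceArea n) * ENNReal.ofReal Real.pi := by
  rw [curveLength, eVariationOn, ENNReal.mul_iSup]
  refine iSup_le ?_
  rintro ⟨N, u, hu, huI⟩
  have hm : ∀ i, MeasurableSet (Subtype.val ⁻¹' lune (γ (u i) : 𝔼 n) (γ (u (i + 1)) : 𝔼 n) :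
      Set (UnitSphere n)) := fun i ↦ measurable_subtype_coe (isOpen_lune _ _).measurableSet
  calc _ ≤ (∑ i ∈ Finset.range N, surfaceArea n (Subtype.val ⁻¹'
        lune (γ (u i) : 𝔼 n) (γ (u (i + 1)) : 𝔼 n))) * ENNReal.ofReal Real.pi := by
        rw [Finset.mul_sum, Finset.sum_mul]
        refine Finset.sum_le_sum fun i _ ↦ ?_
        rw [edist_comm]
        exact edist_le_surfaceArea_lune _ _
    _ ≤ _ := by
        gcongr
        rw [Finset.sum_congr rfl fun i _ ↦ (lintegral_indicator_one (hm i)).symm,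
          ← lintegral_finsetSum _ fun i _ ↦ measurable_one.indicator (hm i)]
        exact lintegral_mono fun Q ↦ sum_indicator_lune_le hI hγ hu huI N Q

/-- The multiplicity vanishes off the union of the equators, so integrating it over that union or
over the whole sphere is the same. -/
theorem sweptArea_eq_lintegral (γ : ℝ → UnitSphere n) (I : Set ℝ) :
    sweptArea γ I = ∫⁻ Q, multiplicity γ I Q ∂surfaceArea n := by
  refine le_antisymm (setLIntegral_le_lintegral _ _) ?_
  refine le_trans (lintegral_mono fun Q ↦ ?_) (lintegral_indicator_le _ _)
  by_cases hQ : Q ∈ ⋃₀ equatorsOfCurve γ I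
  · rw [indicator_of_mem hQ]
  · have : {t ∈ I | Q ∈ equator (γ t)} = ∅ := by
      refine eq_empty_of_forall_notMem fun t ht ↦ hQ ?_
      exact ⟨_, ⟨_, ⟨t, ht.1, rfl⟩, rfl⟩, ht.2⟩
    rw [multiplicity, this]
    simp

end

end EquatorCrofton

theorem lemma2p1 (n : ℕ) (γ : ℝ → EquatorCrofton.UnitSphere n) (I : Set ℝ)
    (hγ : EquatorCrofton.IsRectifiableCurve γ I) :
    Measurable (EquatorCrofton.multiplicity γ I) ∧
      EquatorCrofton.sweptArea γ I / EquatorCrofton.surfaceArea n Set.univ =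
        EquatorCrofton.curveLength γ I / ENNReal.ofReal Real.pi := by
  refine ⟨EquatorCrofton.measurable_multiplicity hγ.ordConnected hγ.continuousOn, ?_⟩
  rw [EquatorCrofton.sweptArea_eq_lintegral]
  have h := le_antisymm
    (EquatorCrofton.lintegral_multiplicity_le hγ.ordConnected hγ.continuousOn)
    (EquatorCrofton.le_lintegral_multiplicity hγ.ordConnected hγ.continuousOn)
  have hpi : ENNReal.ofReal Real.pi ≠ 0 := by simp [Real.pi_pos]
  have hT : EquatorCrofton.surfaceArea n Set.univ ≠ 0 := EquatorCrofton.surfaceArea_univ_ne_zero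
  rw [ENNReal.div_eq_div_iff hpi ENNReal.ofReal_ne_top hT (measure_ne_top _ _), mul_comm, h]
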